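/- Let $0<\nu<\tfrac12$ and $\lambda>0$. Let $H_1^{2\nu}$ and $H_2^{\nu}$ be independent stable subordinators of orders $2\nu$ and $\nu$, i.e. nondecreasing right-continuous processes started at $0$ with stationary independent increments and $\mathbb{E}e^{-\mu H_1^{2\nu}(t)}=e^{-t\mu^{2\nu}}$, $\mathbb{E}e^{-\mu H_2^{\nu}(t)}=e^{-t\mu^{\nu}}$ for all $\mu>0$, $t\ge 0$. Put $$\mathcal{H}^\nu(t)=H_1^{2\nu}(t)+(2\lambda)^{1/\nu}H_2^\nu(t),\qquad t\ge 0 .$$ For every $t>0$ the law of $\mathcal{H}^\nu(t)$ has a (unique) continuous density $x\mapsto \mathfrak{h}_\nu(x,t)$ on $[0,\infty)$, and $\mathfrak{h}_\nu$ solves $$\begin{cases}\dfrac{\partial}{\partial t}\mathfrak{h}_\nu(x,t)=-\left(\dfrac{\partial^{2\nu}}{\partial x^{2\nu}}+2\lambda\dfrac{\partial^{\nu}}{\partial x^{\nu}}\right)\mathfrak{h}_\nu(x,t), & x>0,\ t>0,\\[2mm] \mathfrak{h}_\nu(0,t)=0, & t>0,\\ \mathfrak{h}_\nu(x,0)=\delta(x),\end{cases}$$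 where all the derivatives exist pointwise, and for $0<\alpha<1$ the fractional derivative is the Riemann–Liouville one, $$\frac{\partial^\alpha}{\partial x^\alpha}f(x)=\frac{1}{\Gamma(1-\alpha)}\frac{d}{dx}\int_0^x\frac{f(s)}{(x-s)^{\alpha}}\,ds .$$ The initial condition means that $\mathcal{H}^\nu(0)$ has law $\delta_0$ and that $\lim_{t\downarrow 0}\int_0^\infty\varphi(x)\,\mathfrak{h}_\nu(x,t)\,dx=\varphi(0)$ for every bounded continuous $\varphi:\mathbb{R}\to\mathbb{R}$. -/

import Mathlib

open MeasureTheory ProbabilityTheory Filter Set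
open scoped NNReal Topology BoundedContinuousFunction

noncomputable section

/-- `H` is a stable subordinator of order `α` (`0 < α < 1`) under `P`: a real process started at `0`
with independent and stationary increments and almost surely nondecreasing right-continuous paths,
normalised by `𝔼 exp (-μ H(t)) = exp (-t μ ^ α)` for `μ > 0`. -/
structure IsStableSubordinator {Ω : Type*} [MeasurableSpace Ω] (α : ℝ)
    (H : ℝ≥0 → Ω → ℝ) (P : Measure Ω) : Prop where
  measurable : ∀ t, Measurable (H t)
  start_zero : ∀ᵐ ω ∂P, H 0 ω = 0
  indep_increments : HasIndepIncrements H P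
  stationary_increments : ∀ s t : ℝ≥0,
    IdentDistrib (fun ω => H (s + t) ω - H s ω) (fun ω => H t ω - H 0 ω) P P
  monotone_paths : ∀ᵐ ω ∂P, Monotone fun t => H t ω
  right_continuous_paths : ∀ᵐ ω ∂P, ∀ t, ContinuousWithinAt (fun s => H s ω) (Ici t) t
  laplace : ∀ (t : ℝ≥0) (μ : ℝ), 0 < μ →
    ∫ ω, Real.exp (-μ * H t ω) ∂P = Real.exp (-(t : ℝ) * μ ^ α)

/-- The process `H₁(t) + (2λ)^{1/ν} H₂(t)`. -/
def sumProcess {Ω : Type*} (ν lam : ℝ) (H₁ H₂ : ℝ≥0 → Ω → ℝ) : ℝ≥0 → Ω → ℝ :=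
  fun t ω => H₁ t ω + (2 * lam) ^ (1 / ν) * H₂ t ω

/-- `h x t` (`x ≥ 0`, `t > 0`) is the continuous probability density on `[0, ∞)` of the law
of `X t`. Continuity in `x` selects the version of the density, which is thereby unique. -/
structure IsContinuousDensity {Ω : Type*} [MeasurableSpace Ω] (X : ℝ≥0 → Ω → ℝ) (P : Measure Ω)
    (h : ℝ → ℝ → ℝ) : Prop where
  nonneg : ∀ t : ℝ≥0, 0 < t → ∀ x : ℝ, 0 ≤ x → 0 ≤ h x t
  continuousOn : ∀ t : ℝ≥0, 0 < t → ContinuousOn (fun x => h x t) (Ici 0)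
  map_eq : ∀ t : ℝ≥0, 0 < t →
    P.map (X t) = (volume.restrict (Ici (0 : ℝ))).withDensity (fun x => ENNReal.ofReal (h x t))

/-- The fractional integral `(1 / Γ(1 - α)) ∫₀ˣ f(s) (x - s)^{-α} ds`, whose derivative is
the Riemann–Liouville derivative of order `α ∈ (0, 1)`. -/
def rlIntegral (α : ℝ) (f : ℝ → ℝ) (x : ℝ) : ℝ :=
  1 / Real.Gamma (1 - α) * ∫ s in (0 : ℝ)..x, f s / (x - s) ^ α

/-- The Riemann–Liouville derivative of order `α ∈ (0, 1)`, based at `0`. -/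
def rlDeriv (α : ℝ) (f : ℝ → ℝ) (x : ℝ) : ℝ :=
  deriv (rlIntegral α f) x

/-- The Riemann–Liouville derivative of order `α ∈ (0, 1)` of `f` exists at `x`: near `x` the
fractional integral converges, and it is differentiable at `x`. -/
def RLDifferentiableAt (α : ℝ) (f : ℝ → ℝ) (x : ℝ) : Prop :=
  (∀ᶠ y in 𝓝 x, IntervalIntegrable (fun s => f s / (y - s) ^ α) volume 0 y) ∧
    DifferentiableAt ℝ (rlIntegral α f) x

/-- `h` solves `∂ₜ h = -(∂ₓ^{2ν} + 2λ ∂ₓ^ν) h` for `x, t > 0` pointwise, with all derivatives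
existing, and with `h(0, t) = 0` and `h(x, 0) = δ(x)`. -/
structure SolvesFractionalProblem (ν lam : ℝ) (h : ℝ → ℝ → ℝ) : Prop where
  rl_two_nu : ∀ x t : ℝ, 0 < x → 0 < t → RLDifferentiableAt (2 * ν) (fun y => h y t) x
  rl_nu : ∀ x t : ℝ, 0 < x → 0 < t → RLDifferentiableAt ν (fun y => h y t) x
  equation : ∀ x t : ℝ, 0 < x → 0 < t →
    HasDerivAt (fun s => h x s)
      (-(rlDeriv (2 * ν) (fun y => h y t) x + 2 * lam * rlDeriv ν (fun y => h y t) x)) t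
  boundary : ∀ t : ℝ, 0 < t → h 0 t = 0
  initial : ∀ φ : ℝ →ᵇ ℝ,
    Tendsto (fun t => ∫ x in Ici (0 : ℝ), φ x * h x t) (𝓝[>] 0) (𝓝 (φ 0))

end

/-! Everything is read off the Laplace exponent ψ(s) = s^(2ν) + 2λ s^ν. Independence gives the law μ
of the process at time t the Laplace transform exp(-tψ(r)) for r > 0, and the identity theorem
extends this to Re s > 0. On that half-plane Re ψ(s) ≥ cos(πν)|s|^(2ν) with cos(πν) > 0, so on Re s
= 1 the factor exp(-tψ) beats every power. Hence the contour integrals B_β(x,t) of e^(sx) s^β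
e^(-tψ(s)) converge for all real β and t > 0; ∂_x sends B_β to B_(β+1), and ∂_t B_0 = -(B_(2ν) + 2λ
B_ν) (`hasDerivAt_bromwich_time`).

B_0 is the density: e^(-x)μ(dx) is finite with integrable characteristic function, so Fourier
inversion applies (`HasLaplaceExponent.eq_withDensity`). Since μ does not charge (-∞,0), continuity
forces B_0 = 0 on (-∞,0] (`HasLaplaceExponent.bromwich_eq_zero`). This is the boundary condition,
and it also turns the fractional integral over (0,x) into a convolution with u^(-α) over (0,∞). The
Laplace transform of u^(-α) being Γ(1-α)s^(α-1), the fractional integral of B_0 is B_(α-1) and its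
derivative is B_α (`HasLaplaceExponent.hasDerivAt_rlIntegral`), so the equation is the formula for
∂_t B_0.

The initial condition comes from right-continuity of paths, and uniqueness of the continuous density
carries everything over to an arbitrary one. -/

open scoped FourierTransform

/-! ### Fourier inversion for finite measures on the line -/

/-- The Fourier transform of an integrable function on the line is continuous. -/
theorem continuous_fourier_real {f : ℝ → ℂ} (hf : Integrable f) : Continuous (𝓕 f) :=
  VectorFourier.fourierIntegral_continuous Real.continuous_fourierChar
    (by exact continuous_inner) hf

/-- The heat kernel on the line, in the scaling for which its Fourier transform is
`v ↦ exp (-π b v²)`. -/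
noncomputable def heatKernel (b x : ℝ) : ℝ := 1 / √b * Real.exp (-(Real.pi / b) * x ^ 2)

theorem heatKernel_nonneg (b x : ℝ) : 0 ≤ heatKernel b x := by
  unfold heatKernel; positivity

theorem continuous_heatKernel (b : ℝ) : Continuous (heatKernel b) := by
  unfold heatKernel; fun_prop

theorem integrable_heatKernel {b : ℝ} (hb : 0 < b) : Integrable (heatKernel b) := by
  unfold heatKernel
  exact (integrable_exp_neg_mul_sq (by positivity)).const_mul _

theorem integral_heatKernel {b : ℝ} (hb : 0 < b) : ∫ x, heatKernel b x = 1 := by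
  unfold heatKernel
  rw [integral_const_mul, integral_gaussian]
  have : Real.pi / (Real.pi / b) = b := by field_simp
  rw [this, one_div, inv_mul_cancel₀ (Real.sqrt_pos.2 hb).ne']

theorem fourier_gaussian_eq_heatKernel {b : ℝ} (hb : 0 < b) (x : ℝ) :
    ∫ v : ℝ, Complex.exp (↑(-2 * Real.pi * v * x) * Complex.I) *
      Complex.exp (-Real.pi * b * v ^ 2) = heatKernel b x := by
  have h := congrFun (fourier_gaussian_pi (b := (b : ℂ)) (by simpa using hb)) x
  rw [Real.fourier_real_eq_integral_exp_smul] at h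
  simp only [smul_eq_mul] at h
  rw [h, heatKernel, Real.sqrt_eq_rpow]
  push_cast [Complex.ofReal_cpow hb.le]
  congr 2
  ring

/-- The candidate density `x ↦ (2π)⁻¹ ∫ exp (-i x ξ) φ(ξ) dξ`, `φ` the characteristic function. -/
noncomputable def charDensity (μ : Measure ℝ) : ℝ → ℂ := 𝓕 fun v : ℝ => charFun μ (2 * Real.pi * v)

theorem continuous_charDensity {μ : Measure ℝ}
    (hint : Integrable fun v : ℝ => charFun μ (2 * Real.pi * v)) : Continuous (charDensity μ) :=
  continuous_fourier_real hint

section Inversion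

variable {μ : Measure ℝ} [IsFiniteMeasure μ]

/-- Multiplying the characteristic function by a Gaussian amounts to convolving with the heat
kernel. -/
theorem fourier_gaussian_mul_charFun {b : ℝ} (hb : 0 < b) (x : ℝ) :
    ∫ v : ℝ, Complex.exp (↑(-2 * Real.pi * v * x) * Complex.I) *
      (Complex.exp (-Real.pi * b * v ^ 2) * charFun μ (2 * Real.pi * v)) =
      ((∫ y, heatKernel b (x - y) ∂μ : ℝ) : ℂ) := by
  rw [← integral_complex_ofReal]
  simp_rw [← fourier_gaussian_eq_heatKernel hb]
  rw [integral_integral_swap]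
  · congr 1
    ext v
    rw [charFun_apply_real, ← mul_assoc, ← integral_const_mul]
    congr 1
    ext y
    rw [mul_right_comm, ← Complex.exp_add]
    congr 2
    push_cast
    ring
  · have hg : Integrable (fun v : ℝ => Complex.exp (-Real.pi * b * v ^ 2)) := by
      have := integrable_cexp_neg_mul_sq (b := ((Real.pi * b : ℝ) : ℂ))
        (by rw [Complex.ofReal_re]; positivity)
      refine this.congr (ae_of_all _ fun v => ?_)
      simp
    have h1 : Integrable (fun _ : ℝ => (1 : ℂ)) μ := integrable_const _
    refine (h1.mul_prod hg).mono (by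
      refine Continuous.aestronglyMeasurable ?_
      simp only [Function.uncurry_def]
      fun_prop) (ae_of_all _ fun p => ?_)
    simp only [Function.uncurry, norm_mul, Complex.norm_exp_ofReal_mul_I, norm_one, le_refl]

/-- The Gaussian factors tend to 1 and are bounded by 1, so the characteristic function itself
dominates. As a limit of heat-kernel averages of μ, the candidate density is therefore real and
nonnegative. -/
theorem tendsto_heatKernel_charDensity
    (hint : Integrable fun v : ℝ => charFun μ (2 * Real.pi * v)) (x : ℝ) :
    Tendsto (fun n : ℕ => ((∫ y, heatKernel (1 / ((n : ℝ) + 1)) (x - y) ∂μ : ℝ) : ℂ)) atTop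
      (𝓝 (charDensity μ x)) := by
  simp_rw [← fourier_gaussian_mul_charFun (μ := μ) (Nat.one_div_pos_of_nat (α := ℝ))]
  rw [charDensity, Real.fourier_real_eq_integral_exp_smul]
  have hcf : Continuous (charFun μ) := continuous_charFun
  refine tendsto_integral_filter_of_dominated_convergence _
    (Eventually.of_forall fun n => ?_) (Eventually.of_forall fun n => ae_of_all _ fun v => ?_)
    hint.norm (ae_of_all _ fun v => ?_)
  · exact Continuous.aestronglyMeasurable (by fun_prop)
  · rw [norm_mul, Complex.norm_exp_ofReal_mul_I, one_mul, norm_mul]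
    refine mul_le_of_le_one_left (norm_nonneg _) ?_
    rw [Complex.norm_exp]
    refine Real.exp_le_one_iff.2 ?_
    have : (-(Real.pi : ℂ) * ((1 / ((n : ℝ) + 1) : ℝ) : ℂ) * (v : ℂ) ^ 2) =
      ((-(Real.pi * (1 / ((n : ℝ) + 1)) * v ^ 2) : ℝ) : ℂ) := by push_cast; ring
    rw [this, Complex.ofReal_re]
    have : 0 ≤ Real.pi * (1 / ((n : ℝ) + 1)) * v ^ 2 := by positivity
    linarith
  · have h0 : Tendsto (fun n : ℕ => ((1 / ((n : ℝ) + 1) : ℝ) : ℂ)) atTop (𝓝 0) := by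
      exact_mod_cast (Complex.continuous_ofReal.tendsto _).comp
        (tendsto_one_div_add_atTop_nhds_zero_nat (𝕜 := ℝ))
    have h1 : Tendsto (fun n : ℕ => Complex.exp (-Real.pi * ((1 / ((n : ℝ) + 1) : ℝ) : ℂ) * v ^ 2))
        atTop (𝓝 1) := by
      have := (Complex.continuous_exp.tendsto _).comp ((h0.const_mul (-(Real.pi : ℂ))).mul_const
        ((v : ℂ) ^ 2))
      simpa [Function.comp_def] using this
    simpa using (h1.mul_const (charFun μ (2 * Real.pi * v))).const_mul
      (Complex.exp (↑(-2 * Real.pi * v * x) * Complex.I))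

theorem tendsto_heatKernel_charDensity_re
    (hint : Integrable fun v : ℝ => charFun μ (2 * Real.pi * v)) (x : ℝ) :
    Tendsto (fun n : ℕ => ∫ y, heatKernel (1 / ((n : ℝ) + 1)) (x - y) ∂μ) atTop
      (𝓝 (charDensity μ x).re) := by
  simpa [Function.comp_def] using
    (Complex.continuous_re.tendsto _).comp (tendsto_heatKernel_charDensity hint x)

theorem charDensity_re_nonneg
    (hint : Integrable fun v : ℝ => charFun μ (2 * Real.pi * v)) (x : ℝ) :
    0 ≤ (charDensity μ x).re :=
  ge_of_tendsto' (tendsto_heatKernel_charDensity_re hint x)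
    fun _ => integral_nonneg fun _ => heatKernel_nonneg _ _

theorem ofReal_re_charDensity
    (hint : Integrable fun v : ℝ => charFun μ (2 * Real.pi * v)) (x : ℝ) :
    ((charDensity μ x).re : ℂ) = charDensity μ x := by
  have h := (Complex.continuous_im.tendsto _).comp (tendsto_heatKernel_charDensity hint x)
  have h0 : (charDensity μ x).im = 0 := by
    refine tendsto_nhds_unique h ?_
    simp [Function.comp_def]
  exact Complex.ext (by simp) (by simp [h0])

theorem lintegral_integral_heatKernel {b : ℝ} (hb : 0 < b) :
    ∫⁻ x, ENNReal.ofReal (∫ y, heatKernel b (x - y) ∂μ) = μ univ := by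
  have hk := continuous_heatKernel b
  have hi (x : ℝ) : Integrable (fun y => heatKernel b (x - y)) μ := by
    refine Integrable.of_bound (Continuous.aestronglyMeasurable (by fun_prop)) (1 / √b)
      (ae_of_all _ fun y => ?_)
    rw [Real.norm_of_nonneg (heatKernel_nonneg _ _), heatKernel]
    refine mul_le_of_le_one_right (by positivity) (Real.exp_le_one_iff.2 ?_)
    have : 0 ≤ Real.pi / b * (x - y) ^ 2 := by positivity
    linarith
  simp_rw [fun x => ofReal_integral_eq_lintegral_ofReal (hi x)
    (ae_of_all _ fun y => heatKernel_nonneg b (x - y))]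
  rw [lintegral_lintegral_swap]
  · have (y : ℝ) : ∫⁻ x, ENNReal.ofReal (heatKernel b (x - y)) = 1 := by
      rw [lintegral_sub_right_eq_self (fun x => ENNReal.ofReal (heatKernel b x)) y,
        ← ofReal_integral_eq_lintegral_ofReal (integrable_heatKernel hb)
          (ae_of_all _ fun y => heatKernel_nonneg b y), integral_heatKernel hb, ENNReal.ofReal_one]
    simp [this]
  · refine Continuous.aemeasurable ?_
    simp only [Function.uncurry_def]
    exact ENNReal.continuous_ofReal.comp (by fun_prop)

/-- Fatou along the heat-kernel averages, each of total mass `μ univ`. The inequality is enough: it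
gives the integrability that Fourier inversion requires. -/
theorem lintegral_charDensity_le
    (hint : Integrable fun v : ℝ => charFun μ (2 * Real.pi * v)) :
    ∫⁻ x, ENNReal.ofReal (charDensity μ x).re ≤ μ univ := by
  have h1 (x : ℝ) : ENNReal.ofReal (charDensity μ x).re =
      liminf (fun n : ℕ => ENNReal.ofReal (∫ y, heatKernel (1 / ((n : ℝ) + 1)) (x - y) ∂μ))
        atTop :=
    ((ENNReal.tendsto_ofReal (tendsto_heatKernel_charDensity_re hint x)).liminf_eq).symm
  simp_rw [h1]
  refine (lintegral_liminf_le fun n => ?_).trans ?_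
  · refine ENNReal.measurable_ofReal.comp (StronglyMeasurable.measurable ?_)
    have hk := continuous_heatKernel (1 / ((n : ℝ) + 1))
    refine StronglyMeasurable.integral_prod_right
      (f := fun x y => heatKernel (1 / ((n : ℝ) + 1)) (x - y)) ?_
    refine Continuous.stronglyMeasurable ?_
    simp only [Function.uncurry_def]
    fun_prop
  · simp_rw [lintegral_integral_heatKernel (μ := μ) (Nat.one_div_pos_of_nat (α := ℝ))]
    simp

theorem integrable_charDensity
    (hint : Integrable fun v : ℝ => charFun μ (2 * Real.pi * v)) : Integrable (charDensity μ) := by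
  have hre : Integrable fun x => (charDensity μ x).re := by
    refine ⟨(Complex.continuous_re.comp (continuous_charDensity hint)).aestronglyMeasurable, ?_⟩
    rw [hasFiniteIntegral_iff_ofReal (ae_of_all _ fun x => charDensity_re_nonneg hint x)]
    exact (lintegral_charDensity_le hint).trans_lt (measure_lt_top _ _)
  refine hre.ofReal.congr (ae_of_all _ fun x => ?_)
  exact ofReal_re_charDensity hint x

/-- A finite measure on the line with integrable characteristic function has a continuous density,
given by Fourier inversion. -/
theorem eq_withDensity_charDensity
    (hint : Integrable fun v : ℝ => charFun μ (2 * Real.pi * v)) :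
    μ = volume.withDensity fun x => ENNReal.ofReal (charDensity μ x).re := by
  have hfin : IsFiniteMeasure (volume.withDensity fun x => ENNReal.ofReal (charDensity μ x).re) :=
    isFiniteMeasure_withDensity
      ((lintegral_charDensity_le hint).trans_lt (measure_lt_top _ _)).ne
  refine Measure.ext_of_charFun ?_
  have hcf : Continuous (charFun μ) := continuous_charFun
  have hinv := Continuous.fourierInv_fourier_eq (f := fun v : ℝ => charFun μ (2 * Real.pi * v))
    (by fun_prop) hint (integrable_charDensity hint)
  ext ξ
  -- The rescaling reconciles the kernel e^(iξx) of `charFun` with the kernel e^(2πivx) of the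
  -- inverse Fourier transform.
  have hξ := congrFun hinv (ξ / (2 * Real.pi))
  have hpi : 2 * Real.pi * (ξ / (2 * Real.pi)) = ξ := by field_simp
  simp only [hpi] at hξ
  rw [← hξ, Real.fourierInv_eq', charFun_apply_real,
    integral_withDensity_eq_integral_toReal_smul
      (by
        have := continuous_charDensity hint
        exact ENNReal.measurable_ofReal.comp (Complex.continuous_re.comp this).measurable)
      (ae_of_all _ fun _ => ENNReal.ofReal_lt_top)]
  congr 1
  ext x
  rw [ENNReal.toReal_ofReal (charDensity_re_nonneg hint x), Complex.real_smul,
    ofReal_re_charDensity hint, smul_eq_mul, mul_comm]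
  congr 2
  have : 2 * Real.pi * inner ℝ x (ξ / (2 * Real.pi)) = ξ * x := by
    simp only [RCLike.inner_apply, conj_trivial]
    field_simp
  rw [this]
  push_cast
  ring

end Inversion

/-! ### Estimates on the line Re s = 1 -/

/-- A parametrisation of the vertical line `Re s = 1`. -/
noncomputable def verticalLine (v : ℝ) : ℂ := 1 - ((2 * Real.pi * v : ℝ) : ℂ) * Complex.I

theorem verticalLine_re (v : ℝ) : (verticalLine v).re = 1 := by simp [verticalLine]

theorem continuous_verticalLine : Continuous verticalLine := by
  unfold verticalLine; fun_prop

theorem verticalLine_mem_slitPlane (v : ℝ) : verticalLine v ∈ Complex.slitPlane :=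
  Or.inl (by simp [verticalLine_re])

theorem verticalLine_ne_zero (v : ℝ) : verticalLine v ≠ 0 :=
  Complex.slitPlane_ne_zero (verticalLine_mem_slitPlane v)

theorem norm_verticalLine_sq (v : ℝ) : ‖verticalLine v‖ ^ 2 = 1 + (2 * Real.pi * v) ^ 2 := by
  rw [Complex.sq_norm, Complex.normSq_apply]
  simp [verticalLine]
  ring

theorem one_le_norm_verticalLine (v : ℝ) : 1 ≤ ‖verticalLine v‖ := by
  simpa [verticalLine_re] using Complex.re_le_norm (verticalLine v)

theorem continuous_verticalLine_cpow (a : ℂ) : Continuous fun v => verticalLine v ^ a :=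
  continuous_verticalLine.cpow continuous_const verticalLine_mem_slitPlane

/-- Powers are dominated by stretched exponentials. -/
theorem exists_rpow_mul_exp_neg_le {p q a : ℝ} (hq : 0 < q) (ha : 0 < a) :
    ∃ C : ℝ, ∀ r : ℝ, 1 ≤ r → r ^ p * Real.exp (-a * r ^ q) ≤ C * (r ^ 2)⁻¹ := by
  -- With qn ≥ p + 2, the n-th term of the series of exp(a r^q) already dominates r^(p+2) up to a
  -- constant.
  obtain ⟨n, hn⟩ := exists_nat_ge ((p + 2) / q)
  refine ⟨n.factorial / a ^ n, fun r hr => ?_⟩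
  have hr0 : 0 < r := by linarith
  have h1 := Real.pow_div_factorial_le_exp (a * r ^ q) (by positivity) n
  have h2 : r ^ (p + 2) ≤ (r ^ q) ^ n := by
    rw [← Real.rpow_natCast, ← Real.rpow_mul hr0.le]
    refine Real.rpow_le_rpow_of_exponent_le hr ?_
    rw [div_le_iff₀ hq] at hn
    linarith
  have h3 : r ^ p = r ^ (p + 2) * (r ^ 2)⁻¹ := by
    rw [Real.rpow_add hr0, Real.rpow_two]
    field_simp
  rw [neg_mul, Real.exp_neg, h3, mul_right_comm]
  refine mul_le_mul_of_nonneg_right ?_ (by positivity)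
  rw [← div_eq_mul_inv, div_le_iff₀ (Real.exp_pos _)]
  refine h2.trans ?_
  rw [div_mul_eq_mul_div, le_div_iff₀ (by positivity)]
  rw [div_le_iff₀ (by positivity), mul_pow] at h1
  linarith

theorem integrable_norm_verticalLine_rpow_mul_exp {p q a : ℝ} (hq : 0 < q) (ha : 0 < a) :
    Integrable fun v => ‖verticalLine v‖ ^ p * Real.exp (-a * ‖verticalLine v‖ ^ q) := by
  obtain ⟨C, hC⟩ := exists_rpow_mul_exp_neg_le (p := p) hq ha
  have hi : Integrable fun v : ℝ => C * (1 + (2 * Real.pi * v) ^ 2)⁻¹ :=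
    (integrable_inv_one_add_sq.comp_mul_left' (R := 2 * Real.pi) (by positivity)).const_mul C
  refine hi.mono' (Continuous.aestronglyMeasurable ?_) (ae_of_all _ fun v => ?_)
  · have hc (e : ℝ) : Continuous fun v => ‖verticalLine v‖ ^ e :=
      continuous_verticalLine.norm.rpow_const
        fun v => Or.inl (norm_ne_zero_iff.2 (verticalLine_ne_zero v))
    exact (hc p).mul (Real.continuous_exp.comp ((hc q).const_mul _))
  · rw [Real.norm_of_nonneg (by positivity), ← norm_verticalLine_sq]
    exact hC _ (one_le_norm_verticalLine v)

/-- Re s^α = |s|^α cos(α arg s), where |α arg s| ≤ πα/2 ≤ π, and cosine decreases on [0,π]. -/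
theorem cos_mul_norm_rpow_le_re_cpow {s : ℂ} (hs : 0 ≤ s.re) {α : ℝ} (h0 : 0 ≤ α) (h1 : α ≤ 1) :
    Real.cos (Real.pi * α / 2) * ‖s‖ ^ α ≤ (s ^ (α : ℂ)).re := by
  rw [Complex.cpow_ofReal_re, mul_comm]
  refine mul_le_mul_of_nonneg_left ?_ (by positivity)
  rw [← Real.cos_abs (s.arg * α)]
  have h2 := Complex.abs_arg_le_pi_div_two_iff.2 hs
  rw [abs_mul, abs_of_nonneg h0]
  refine Real.cos_le_cos_of_nonneg_of_le_pi (by positivity) ?_ ?_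
  · nlinarith [Real.pi_pos]
  · nlinarith

/-! ### Bromwich integrals and their derivatives -/

/-- The Laplace exponent `s ↦ s ^ (2ν) + 2λ s ^ ν`. -/
noncomputable def laplaceSymbol (ν lam : ℝ) (s : ℂ) : ℂ :=
  s ^ ((2 * ν : ℝ) : ℂ) + 2 * lam * s ^ (ν : ℂ)

/-- The function `exp (s x) s ^ β exp (-t ψ(s))` on the line `Re s = 1`, `ψ` the Laplace
exponent. -/
noncomputable def bromwichIntegrand (ν lam β t x v : ℝ) : ℂ :=
  Complex.exp (x * verticalLine v) *
    (verticalLine v ^ (β : ℂ) * Complex.exp (-t * laplaceSymbol ν lam (verticalLine v)))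

/-- The contour integral `(2πi)⁻¹ ∫ exp (s x) s ^ β exp (-t ψ(s)) ds` over `Re s = 1`. -/
noncomputable def bromwich (ν lam β t x : ℝ) : ℂ := ∫ v, bromwichIntegrand ν lam β t x v

section Bromwich

variable {ν lam : ℝ}

theorem cos_pi_mul_pos (hν : 0 < ν) (hν' : ν < 1 / 2) : 0 < Real.cos (Real.pi * ν) :=
  Real.cos_pos_of_mem_Ioo ⟨by nlinarith [Real.pi_pos], by nlinarith [Real.pi_pos]⟩

/-- The term 2λ s^ν has nonnegative real part and is dropped; the leading power alone gives the
decay. -/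
theorem cos_mul_norm_rpow_le_re_laplaceSymbol (hν : 0 < ν) (hν' : ν < 1 / 2) (hlam : 0 < lam)
    {s : ℂ} (hs : 0 ≤ s.re) :
    Real.cos (Real.pi * ν) * ‖s‖ ^ (2 * ν) ≤ (laplaceSymbol ν lam s).re := by
  have h1 := cos_mul_norm_rpow_le_re_cpow hs (α := 2 * ν) (by linarith) (by linarith)
  have h2 := cos_mul_norm_rpow_le_re_cpow hs (α := ν) (by linarith) (by linarith)
  have h3 : 0 ≤ Real.cos (Real.pi * ν / 2) :=
    Real.cos_nonneg_of_mem_Icc ⟨by nlinarith [Real.pi_pos], by nlinarith [Real.pi_pos]⟩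
  have h4 : (laplaceSymbol ν lam s).re = (s ^ ((2 * ν : ℝ) : ℂ)).re +
      2 * lam * (s ^ (ν : ℂ)).re := by
    have : (2 * lam * s ^ (ν : ℂ)) = ((2 * lam : ℝ) : ℂ) * s ^ (ν : ℂ) := by push_cast; ring
    rw [laplaceSymbol, this, Complex.add_re, Complex.re_ofReal_mul]
  have h5 : 0 ≤ (s ^ (ν : ℂ)).re := le_trans (by positivity) h2
  have h6 : Real.pi * (2 * ν) / 2 = Real.pi * ν := by ring
  rw [h6] at h1
  rw [h4]
  have := mul_nonneg (mul_nonneg zero_le_two hlam.le) h5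
  linarith

theorem norm_exp_neg_mul_laplaceSymbol_le (hν : 0 < ν) (hν' : ν < 1 / 2) (hlam : 0 < lam)
    {s : ℂ} (hs : 0 ≤ s.re) {t₀ t : ℝ} (ht₀ : 0 ≤ t₀) (ht : t₀ ≤ t) :
    ‖Complex.exp (-t * laplaceSymbol ν lam s)‖ ≤
      Real.exp (-(t₀ * Real.cos (Real.pi * ν)) * ‖s‖ ^ (2 * ν)) := by
  have h := cos_mul_norm_rpow_le_re_laplaceSymbol hν hν' hlam hs
  have hc := cos_pi_mul_pos hν hν'
  have h0 : 0 ≤ Real.cos (Real.pi * ν) * ‖s‖ ^ (2 * ν) := by positivity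
  rw [Complex.norm_exp, ← Complex.ofReal_neg, Complex.re_ofReal_mul]
  refine Real.exp_le_exp.2 ?_
  nlinarith [mul_le_mul ht h h0 (ht₀.trans ht)]

/-- Allowing t₀ < t gives one majorant for all times beyond t₀, as differentiation in t requires. -/
theorem norm_bromwichIntegrand_le (hν : 0 < ν) (hν' : ν < 1 / 2) (hlam : 0 < lam)
    {t₀ t : ℝ} (ht₀ : 0 ≤ t₀) (ht : t₀ ≤ t) (β x v : ℝ) :
    ‖bromwichIntegrand ν lam β t x v‖ ≤ Real.exp x * (‖verticalLine v‖ ^ β *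
      Real.exp (-(t₀ * Real.cos (Real.pi * ν)) * ‖verticalLine v‖ ^ (2 * ν))) := by
  rw [bromwichIntegrand, norm_mul, norm_mul, Complex.norm_exp, Complex.re_ofReal_mul,
    verticalLine_re, mul_one, Complex.norm_cpow_real]
  gcongr
  exact norm_exp_neg_mul_laplaceSymbol_le hν hν' hlam (by simp [verticalLine_re]) ht₀ ht

theorem continuous_laplaceSymbol_verticalLine :
    Continuous fun v => laplaceSymbol ν lam (verticalLine v) := by
  unfold laplaceSymbol
  exact (continuous_verticalLine_cpow _).add ((continuous_verticalLine_cpow _).const_mul _)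

theorem continuous_bromwichIntegrand (β t : ℝ) :
    Continuous fun p : ℝ × ℝ => bromwichIntegrand ν lam β t p.1 p.2 := by
  unfold bromwichIntegrand
  have h1 := continuous_verticalLine
  have h2 := (continuous_verticalLine_cpow β).comp (continuous_snd (X := ℝ))
  have h3 := (continuous_laplaceSymbol_verticalLine (ν := ν) (lam := lam)).comp
    (continuous_snd (X := ℝ))
  exact Continuous.mul (by fun_prop) (h2.mul (Complex.continuous_exp.comp (h3.const_mul _)))

theorem continuous_bromwichIntegrand_right (β t x : ℝ) :
    Continuous (bromwichIntegrand ν lam β t x) :=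
  (continuous_bromwichIntegrand β t).comp (by fun_prop : Continuous fun v : ℝ => (x, v))

theorem integrable_bromwich_bound (hν : 0 < ν) (hν' : ν < 1 / 2) {t : ℝ} (ht : 0 < t) (β : ℝ) :
    Integrable fun v => ‖verticalLine v‖ ^ β *
      Real.exp (-(t * Real.cos (Real.pi * ν)) * ‖verticalLine v‖ ^ (2 * ν)) :=
  integrable_norm_verticalLine_rpow_mul_exp (by linarith) (mul_pos ht (cos_pi_mul_pos hν hν'))

theorem integrable_bromwichIntegrand (hν : 0 < ν) (hν' : ν < 1 / 2) (hlam : 0 < lam)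
    {t : ℝ} (ht : 0 < t) (β x : ℝ) : Integrable (bromwichIntegrand ν lam β t x) :=
  ((integrable_bromwich_bound hν hν' ht β).const_mul (Real.exp x)).mono'
    (continuous_bromwichIntegrand_right β t x).aestronglyMeasurable
    (ae_of_all _ fun v => norm_bromwichIntegrand_le hν hν' hlam ht.le le_rfl β x v)

theorem mul_bromwichIntegrand (a β t x v : ℝ) :
    verticalLine v ^ (a : ℂ) * bromwichIntegrand ν lam β t x v =
      bromwichIntegrand ν lam (β + a) t x v := by
  rw [bromwichIntegrand, bromwichIntegrand, Complex.ofReal_add,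
    Complex.cpow_add _ _ (verticalLine_ne_zero v)]
  ring

theorem hasDerivAt_bromwich_right (hν : 0 < ν) (hν' : ν < 1 / 2) (hlam : 0 < lam)
    {t : ℝ} (ht : 0 < t) (β x : ℝ) :
    HasDerivAt (bromwich ν lam β t) (bromwich ν lam (β + 1) t x) x := by
  refine (hasDerivAt_integral_of_dominated_loc_of_deriv_le
    (F := fun y v => bromwichIntegrand ν lam β t y v)
    (F' := fun y v => bromwichIntegrand ν lam (β + 1) t y v)
    (bound := fun v => Real.exp (x + 1) * (‖verticalLine v‖ ^ (β + 1) *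
      Real.exp (-(t * Real.cos (Real.pi * ν)) * ‖verticalLine v‖ ^ (2 * ν))))
    (Iio_mem_nhds (lt_add_one x))
    (Eventually.of_forall fun y => (continuous_bromwichIntegrand_right β t y).aestronglyMeasurable)
    (integrable_bromwichIntegrand hν hν' hlam ht β x)
    (continuous_bromwichIntegrand_right _ t x).aestronglyMeasurable
    (ae_of_all _ fun v y hy => ?_)
    ((integrable_bromwich_bound hν hν' ht _).const_mul _)
    (ae_of_all _ fun v y hy => ?_)).2
  · refine (norm_bromwichIntegrand_le hν hν' hlam ht.le le_rfl _ y v).trans ?_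
    gcongr
    exact le_of_lt hy
  · have h1 : HasDerivAt (fun z : ℝ => Complex.exp (z * verticalLine v))
        (Complex.exp (y * verticalLine v) * (1 * verticalLine v)) y :=
      ((Complex.ofRealCLM.hasDerivAt (x := y)).mul_const (verticalLine v)).cexp
    have h2 := h1.mul_const (verticalLine v ^ (β : ℂ) *
      Complex.exp (-t * laplaceSymbol ν lam (verticalLine v)))
    rw [← mul_bromwichIntegrand]
    refine h2.congr_deriv ?_
    rw [bromwichIntegrand, Complex.ofReal_one, Complex.cpow_one]
    ring

/-- Differentiation in time multiplies the integrand by -ψ(s), which shifts the exponent β from 0 to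
2ν and to ν. Times s > t/2 share an integrable majorant. -/
theorem hasDerivAt_bromwich_time (hν : 0 < ν) (hν' : ν < 1 / 2) (hlam : 0 < lam)
    {t : ℝ} (ht : 0 < t) (x : ℝ) :
    HasDerivAt (fun s => bromwich ν lam 0 s x)
      (-(bromwich ν lam (2 * ν) t x + 2 * lam * bromwich ν lam ν t x)) t := by
  have hval (s v : ℝ) : bromwichIntegrand ν lam 0 s x v *
      (-(laplaceSymbol ν lam (verticalLine v))) =
      -(bromwichIntegrand ν lam (2 * ν) s x v + 2 * lam * bromwichIntegrand ν lam ν s x v) := by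
    have h1 := mul_bromwichIntegrand (ν := ν) (lam := lam) (2 * ν) 0 s x v
    have h2 := mul_bromwichIntegrand (ν := ν) (lam := lam) ν 0 s x v
    rw [zero_add] at h1 h2
    rw [← h1, ← h2, laplaceSymbol]
    ring
  have h := hasDerivAt_integral_of_dominated_loc_of_deriv_le (μ := volume) (x₀ := t)
    (F := fun s v => bromwichIntegrand ν lam 0 s x v)
    (F' := fun s v => bromwichIntegrand ν lam 0 s x v *
      (-(laplaceSymbol ν lam (verticalLine v))))
    (bound := fun v => Real.exp x * (‖verticalLine v‖ ^ (2 * ν) *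
      Real.exp (-((t / 2) * Real.cos (Real.pi * ν)) * ‖verticalLine v‖ ^ (2 * ν))) +
      (2 * lam) * (Real.exp x * (‖verticalLine v‖ ^ ν *
      Real.exp (-((t / 2) * Real.cos (Real.pi * ν)) * ‖verticalLine v‖ ^ (2 * ν)))))
    (Ioi_mem_nhds (half_lt_self ht))
    (Eventually.of_forall fun y => (continuous_bromwichIntegrand_right 0 y x).aestronglyMeasurable)
    (integrable_bromwichIntegrand hν hν' hlam ht 0 x)
    ((continuous_bromwichIntegrand_right 0 t x).mul
      continuous_laplaceSymbol_verticalLine.neg).aestronglyMeasurable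
    (ae_of_all _ fun v s hs => ?_)
    (((integrable_bromwich_bound hν hν' (half_pos ht) _).const_mul _).add
      (((integrable_bromwich_bound hν hν' (half_pos ht) _).const_mul _).const_mul _))
    (ae_of_all _ fun v s hs => ?_)
  · refine h.2.congr_deriv ?_
    simp only [hval]
    rw [integral_neg, integral_add (integrable_bromwichIntegrand hν hν' hlam ht _ x)
      ((integrable_bromwichIntegrand hν hν' hlam ht _ x).const_mul _), integral_const_mul]
    rfl
  · rw [hval, norm_neg]
    refine (norm_add_le _ _).trans ?_
    rw [norm_mul (2 * (lam : ℂ))]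
    have hl : ‖(2 * (lam : ℂ))‖ = 2 * lam := by
      rw [norm_mul, Complex.norm_real, Real.norm_of_nonneg hlam.le]; simp
    rw [hl]
    have hs' : t / 2 ≤ s := le_of_lt hs
    gcongr
    · exact norm_bromwichIntegrand_le hν hν' hlam (half_pos ht).le hs' _ x v
    · exact norm_bromwichIntegrand_le hν hν' hlam (half_pos ht).le hs' _ x v
  · have h1 : HasDerivAt (fun z : ℝ => Complex.exp (-z * laplaceSymbol ν lam (verticalLine v)))
        (Complex.exp (-s * laplaceSymbol ν lam (verticalLine v)) *
          (-1 * laplaceSymbol ν lam (verticalLine v))) s :=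
      ((Complex.ofRealCLM.hasDerivAt (x := s)).neg.mul_const _).cexp
    have h2 := (h1.const_mul (verticalLine v ^ ((0 : ℝ) : ℂ))).const_mul
      (Complex.exp (x * verticalLine v))
    refine h2.congr_deriv ?_
    simp only [bromwichIntegrand]
    ring

end Bromwich

/-! ### Complex Laplace transforms and fractional integration -/

/-- Analytic continuation of a Laplace transform from the positive half-line to the right
half-plane. -/
theorem complexMGF_neg_eq_of_mgf_neg_eq {Ω : Type*} [MeasurableSpace Ω] {μ : Measure Ω} {X : Ω → ℝ}
    {g : ℂ → ℂ} (hg : DifferentiableOn ℂ g {s | 0 < s.re})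
    (h : ∀ r : ℝ, 0 < r → (mgf X μ (-r) : ℂ) = g r) (hne : ∀ r : ℝ, 0 < r → g r ≠ 0)
    {s : ℂ} (hs : 0 < s.re) : complexMGF X μ (-s) = g s := by
  -- Where the exponential is not integrable, `mgf` takes the default value 0; the nonvanishing of g
  -- excludes this.
  have hsub : Iio (0 : ℝ) ⊆ interior (integrableExpSet X μ) := by
    refine interior_maximal (fun r hr => ?_) isOpen_Iio
    by_contra hcon
    have h1 := h (-r) (neg_pos.2 hr)
    rw [neg_neg, mgf_undef hcon] at h1
    exact hne (-r) (neg_pos.2 hr) (by exact_mod_cast h1.symm)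
  have hU : IsOpen {s : ℂ | 0 < s.re} := isOpen_lt continuous_const Complex.continuous_re
  have hF : AnalyticOnNhd ℂ (fun z => complexMGF X μ (-z)) {s | 0 < s.re} := by
    refine DifferentiableOn.analyticOnNhd ?_ hU
    refine differentiableOn_complexMGF.comp (differentiable_neg.differentiableOn) fun z hz => ?_
    exact hsub (by simpa using hz)
  refine AnalyticOnNhd.eqOn_of_preconnected_of_frequently_eq hF (hg.analyticOnNhd hU)
    (convex_halfSpace_re_gt 0).isPreconnected (z₀ := 1) (by simp) ?_ hs
  -- The real points 1 + 1/(n+1) accumulate at 1, which is what the identity theorem needs.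
  have ht : Tendsto (fun n : ℕ => ((1 + 1 / ((n : ℝ) + 1) : ℝ) : ℂ)) atTop (𝓝[≠] 1) := by
    refine tendsto_nhdsWithin_iff.2 ⟨?_, Eventually.of_forall fun n => ?_⟩
    · have := (Complex.continuous_ofReal.tendsto _).comp
        ((tendsto_one_div_add_atTop_nhds_zero_nat (𝕜 := ℝ)).const_add 1)
      simpa only [add_zero, Complex.ofReal_one, Function.comp_def] using this
    · have : (0 : ℝ) < 1 / ((n : ℝ) + 1) := Nat.one_div_pos_of_nat
      intro hcon
      have h2 : (1 + 1 / ((n : ℝ) + 1) : ℝ) = 1 :=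
        Complex.ofReal_injective ((mem_singleton_iff.1 hcon).trans Complex.ofReal_one.symm)
      linarith
  refine ht.frequently (Frequently.of_forall fun n => ?_)
  have hp : (0 : ℝ) < 1 + 1 / ((n : ℝ) + 1) := by positivity
  have := h _ hp
  rw [← complexMGF_ofReal] at this
  simpa using this

/-- The Laplace transform of a negative power, at complex arguments. -/
theorem integral_rpow_neg_mul_cexp {α : ℝ} (hα : α < 1) {s : ℂ} (hs : 0 < s.re) :
    ∫ u in Ioi (0 : ℝ), ((u ^ (-α) : ℝ) : ℂ) * Complex.exp (-s * u) =
      Real.Gamma (1 - α) * s ^ ((α - 1 : ℝ) : ℂ) := by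
  -- Treating u^(-α) du as a measure reduces the claim to the real Gamma integral and analytic
  -- continuation.
  set γ : Measure ℝ := (volume.restrict (Ioi (0 : ℝ))).withDensity
    fun u => ENNReal.ofReal (u ^ (-α))
  have hm : Measurable fun u : ℝ => ENNReal.ofReal (u ^ (-α)) := by fun_prop
  have hfin : ∀ᵐ u ∂(volume.restrict (Ioi (0 : ℝ))), ENNReal.ofReal (u ^ (-α)) < ⊤ :=
    ae_of_all _ fun _ => ENNReal.ofReal_lt_top
  have hγ : complexMGF id γ (-s) =
      ∫ u in Ioi (0 : ℝ), ((u ^ (-α) : ℝ) : ℂ) * Complex.exp (-s * u) := by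
    rw [complexMGF, integral_withDensity_eq_integral_toReal_smul hm hfin]
    refine setIntegral_congr_fun measurableSet_Ioi fun u hu => ?_
    simp only [id]
    rw [ENNReal.toReal_ofReal (Real.rpow_nonneg (le_of_lt hu) _), Complex.real_smul]
  have hmgf (r : ℝ) (hr : 0 < r) : mgf id γ (-r) = r ^ (α - 1) * Real.Gamma (1 - α) := by
    rw [mgf, integral_withDensity_eq_integral_toReal_smul hm hfin]
    have h1 := Real.integral_rpow_mul_exp_neg_mul_Ioi (a := 1 - α) (by linarith) hr
    rw [one_div, Real.inv_rpow hr.le, ← Real.rpow_neg hr.le, neg_sub] at h1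
    rw [← h1]
    refine setIntegral_congr_fun measurableSet_Ioi fun u hu => ?_
    simp only [id]
    rw [ENNReal.toReal_ofReal (Real.rpow_nonneg (le_of_lt hu) _), smul_eq_mul,
      sub_sub_cancel_left, neg_mul]
  have hΓ : Real.Gamma (1 - α) ≠ 0 := (Real.Gamma_pos_of_pos (by linarith)).ne'
  rw [← hγ]
  refine complexMGF_neg_eq_of_mgf_neg_eq
    (g := fun s => (Real.Gamma (1 - α) : ℂ) * s ^ ((α - 1 : ℝ) : ℂ)) ?_ (fun r hr => ?_)
    (fun r hr => ?_) hs
  · intro z hz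
    refine DifferentiableAt.differentiableWithinAt ?_
    exact (differentiableAt_id.cpow_const (Or.inl hz)).const_mul _
  · rw [hmgf r hr, Complex.ofReal_mul, Complex.ofReal_cpow hr.le, mul_comm]
  · rw [← Complex.ofReal_cpow hr.le, ← Complex.ofReal_mul]
    exact_mod_cast mul_ne_zero hΓ (Real.rpow_pos_of_pos hr _).ne'

/-- Translation by u multiplies the integrand by e^(-su), and Fubini leaves the Laplace transform of
u^(-α). Fubini applies because |e^(-su)| = e^(-u) on the contour, so the norm factors into a Gamma
integrand and an integrable function of v. -/
theorem integral_rpow_neg_mul_bromwich {ν lam : ℝ} (hν : 0 < ν) (hν' : ν < 1 / 2) (hlam : 0 < lam)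
    {t : ℝ} (ht : 0 < t) {α : ℝ} (hα : α < 1) (x : ℝ) :
    ∫ u in Ioi (0 : ℝ), ((u ^ (-α) : ℝ) : ℂ) * bromwich ν lam 0 t (x - u) =
      Real.Gamma (1 - α) * bromwich ν lam (α - 1) t x := by
  have hsplit (u v : ℝ) : bromwichIntegrand ν lam 0 t (x - u) v =
      Complex.exp (-verticalLine v * u) * bromwichIntegrand ν lam 0 t x v := by
    rw [bromwichIntegrand, bromwichIntegrand, ← mul_assoc (Complex.exp (-verticalLine v * u)),
      ← Complex.exp_add]
    congr 2
    push_cast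
    ring
  simp_rw [bromwich, ← integral_const_mul]
  rw [integral_integral_swap]
  · congr 1
    ext v
    simp_rw [hsplit, ← mul_assoc]
    rw [integral_mul_const, integral_rpow_neg_mul_cexp hα (by simp [verticalLine_re]), mul_assoc,
      mul_bromwichIntegrand, zero_add]
  · have h1 : Integrable (fun u : ℝ => u ^ (-α) * Real.exp (-u))
        (volume.restrict (Ioi (0 : ℝ))) := by
      have := Real.GammaIntegral_convergent (s := 1 - α) (by linarith)
      refine this.congr (ae_of_all _ fun u => ?_)
      simp only [sub_sub_cancel_left, mul_comm]
    have h2 := (integrable_bromwichIntegrand hν hν' hlam ht 0 x).norm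
    refine (h1.mul_prod h2).mono' ?_ ?_
    · refine AEStronglyMeasurable.mul ?_ ?_
      · exact Measurable.aestronglyMeasurable (by fun_prop)
      · exact ((continuous_bromwichIntegrand 0 t).comp
          (by fun_prop : Continuous fun p : ℝ × ℝ => (x - p.1, p.2))).aestronglyMeasurable
    · have hmem : ∀ᵐ p ∂((volume.restrict (Ioi (0 : ℝ))).prod (volume : Measure ℝ)),
          p.1 ∈ Ioi (0 : ℝ) :=
        Measure.quasiMeasurePreserving_fst.ae (ae_restrict_mem measurableSet_Ioi)
      filter_upwards [hmem] with p hp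
      simp only [Function.uncurry]
      rw [hsplit, norm_mul, norm_mul, ← mul_assoc, Complex.norm_real,
        Real.norm_of_nonneg (Real.rpow_nonneg (le_of_lt hp) _), Complex.norm_exp,
        mul_comm (-verticalLine p.2), Complex.re_ofReal_mul, Complex.neg_re, verticalLine_re,
        mul_neg, mul_one]

/-! ### From the Laplace transform of a law to its density -/

section Law

variable {ν lam t : ℝ} {μ : Measure ℝ}

/-- The measure `exp (-x) μ(dx)`. -/
noncomputable def expTilt (μ : Measure ℝ) : Measure ℝ :=
  μ.withDensity fun x => ENNReal.ofReal (Real.exp (-x))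

/-- The tilt by e^(-x) moves the Fourier variable from the imaginary axis to the line Re s = 1. -/
theorem charFun_expTilt (v : ℝ) :
    charFun (expTilt μ) (2 * Real.pi * v) = complexMGF id μ (-verticalLine v) := by
  rw [charFun_apply_real, expTilt, integral_withDensity_eq_integral_toReal_smul (by fun_prop)
    (ae_of_all _ fun _ => ENNReal.ofReal_lt_top), complexMGF]
  congr 1
  ext x
  rw [ENNReal.toReal_ofReal (Real.exp_nonneg _), Complex.real_smul, Complex.ofReal_exp,
    ← Complex.exp_add, verticalLine, id]
  congr 1
  push_cast
  ring

theorem withDensity_exp_expTilt :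
    (expTilt μ).withDensity (fun x => ENNReal.ofReal (Real.exp x)) = μ := by
  rw [expTilt, ← withDensity_mul _ (by fun_prop) (by fun_prop)]
  have : ((fun x => ENNReal.ofReal (Real.exp (-x))) * fun x => ENNReal.ofReal (Real.exp x)) =
      (1 : ℝ → ENNReal) := by
    ext x
    rw [Pi.mul_apply, ← ENNReal.ofReal_mul (Real.exp_nonneg _), ← Real.exp_add]
    simp
  rw [this, withDensity_one]

theorem isFiniteMeasure_expTilt [IsFiniteMeasure μ] (hpos : μ (Iio 0) = 0) : IsFiniteMeasure (expTilt μ) := by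
  refine isFiniteMeasure_withDensity (ne_top_of_le_ne_top (measure_ne_top μ univ) ?_)
  calc ∫⁻ x, ENNReal.ofReal (Real.exp (-x)) ∂μ ≤ ∫⁻ _, 1 ∂μ := by
        refine lintegral_mono_ae ?_
        have : ∀ᵐ x ∂μ, x ∉ Iio (0 : ℝ) := measure_eq_zero_iff_ae_notMem.1 hpos
        filter_upwards [this] with x hx
        rw [ENNReal.ofReal_le_one, Real.exp_le_one_iff]
        simpa using hx
    _ = μ univ := by simp

variable (hν : 0 < ν) (hν' : ν < 1 / 2) (hlam : 0 < lam) (ht : 0 < t)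

theorem differentiableOn_exp_neg_mul_laplaceSymbol (ν lam t : ℝ) :
    DifferentiableOn ℂ (fun s => Complex.exp (-t * laplaceSymbol ν lam s)) {s | 0 < s.re} := by
  intro z hz
  refine DifferentiableAt.differentiableWithinAt ?_
  have h (a : ℂ) : DifferentiableAt ℂ (fun s : ℂ => s ^ a) z :=
    differentiableAt_id.cpow_const (Or.inl hz)
  unfold laplaceSymbol
  exact (((h _).add ((h _).const_mul _)).const_mul _).cexp

/-- The measure `μ` has the Laplace transform `exp (-t (r ^ (2ν) + 2λ r ^ ν))`. -/
def HasLaplaceExponent (ν lam t : ℝ) (μ : Measure ℝ) : Prop :=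
  ∀ r : ℝ, 0 < r → mgf id μ (-r) = Real.exp (-t * (r ^ (2 * ν) + 2 * lam * r ^ ν))

theorem HasLaplaceExponent.complexMGF (h : HasLaplaceExponent ν lam t μ) {s : ℂ} (hs : 0 < s.re) :
    complexMGF id μ (-s) = Complex.exp (-t * laplaceSymbol ν lam s) := by
  refine complexMGF_neg_eq_of_mgf_neg_eq (differentiableOn_exp_neg_mul_laplaceSymbol ν lam t)
    (fun r hr => ?_) (fun r hr => Complex.exp_ne_zero _) hs
  rw [h r hr, laplaceSymbol, ← Complex.ofReal_cpow hr.le, ← Complex.ofReal_cpow hr.le]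
  push_cast
  rfl

theorem HasLaplaceExponent.charFun_expTilt (h : HasLaplaceExponent ν lam t μ) (v : ℝ) :
    charFun (expTilt μ) (2 * Real.pi * v) =
      Complex.exp (-t * laplaceSymbol ν lam (verticalLine v)) := by
  rw [_root_.charFun_expTilt, h.complexMGF (by simp [verticalLine_re])]

theorem HasLaplaceExponent.bromwich_eq (h : HasLaplaceExponent ν lam t μ) (x : ℝ) :
    bromwich ν lam 0 t x = (Real.exp x : ℂ) * charDensity (expTilt μ) x := by
  rw [charDensity, Real.fourier_real_eq_integral_exp_smul, ← integral_const_mul, bromwich]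
  congr 1
  ext v
  have hexp : Complex.exp (x * verticalLine v) =
      (Real.exp x : ℂ) * Complex.exp (↑(-2 * Real.pi * v * x) * Complex.I) := by
    rw [Complex.ofReal_exp, ← Complex.exp_add, verticalLine]
    congr 1
    push_cast
    ring
  rw [h.charFun_expTilt, bromwichIntegrand, Complex.ofReal_zero, Complex.cpow_zero, one_mul,
    smul_eq_mul, ← mul_assoc, hexp]

include hν hν' hlam ht

theorem HasLaplaceExponent.integrable_charFun (h : HasLaplaceExponent ν lam t μ) :
    Integrable fun v : ℝ => charFun (expTilt μ) (2 * Real.pi * v) := by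
  refine (integrable_bromwichIntegrand hν hν' hlam ht 0 0).congr (ae_of_all _ fun v => ?_)
  simp [h.charFun_expTilt, bromwichIntegrand]

theorem continuous_bromwich (β : ℝ) : Continuous (bromwich ν lam β t) :=
  continuous_iff_continuousAt.2 fun x =>
    (hasDerivAt_bromwich_right hν hν' hlam ht β x).continuousAt

variable [IsFiniteMeasure μ]

theorem HasLaplaceExponent.ofReal_re_bromwich (h : HasLaplaceExponent ν lam t μ)
    (hpos : μ (Iio 0) = 0) (x : ℝ) :
    ((bromwich ν lam 0 t x).re : ℂ) = bromwich ν lam 0 t x := by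
  have := isFiniteMeasure_expTilt hpos
  rw [h.bromwich_eq, Complex.re_ofReal_mul, Complex.ofReal_mul,
    ofReal_re_charDensity (h.integrable_charFun hν hν' hlam ht)]

theorem HasLaplaceExponent.re_bromwich_nonneg (h : HasLaplaceExponent ν lam t μ)
    (hpos : μ (Iio 0) = 0) (x : ℝ) : 0 ≤ (bromwich ν lam 0 t x).re := by
  have := isFiniteMeasure_expTilt hpos
  rw [h.bromwich_eq, Complex.re_ofReal_mul]
  exact mul_nonneg (Real.exp_nonneg _)
    (charDensity_re_nonneg (h.integrable_charFun hν hν' hlam ht) x)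

/-- Fourier inversion gives the density of the tilted measure; multiplying by e^x undoes the tilt
and produces the Bromwich integral. -/
theorem HasLaplaceExponent.eq_withDensity (h : HasLaplaceExponent ν lam t μ)
    (hpos : μ (Iio 0) = 0) :
    μ = volume.withDensity fun x => ENNReal.ofReal (bromwich ν lam 0 t x).re := by
  have := isFiniteMeasure_expTilt hpos
  have hint := h.integrable_charFun hν hν' hlam ht
  have hc := continuous_charDensity hint
  conv_lhs => rw [← withDensity_exp_expTilt (μ := μ), eq_withDensity_charDensity hint]
  rw [← withDensity_mul _ (by fun_prop) (by fun_prop)]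
  congr 1
  ext x
  rw [Pi.mul_apply, h.bromwich_eq, Complex.re_ofReal_mul, mul_comm,
    ENNReal.ofReal_mul (Real.exp_nonneg _)]

/-- The density vanishes almost everywhere on the negative half-line, hence by continuity everywhere
on its closure. No contour needs to be shifted, and the endpoint 0 is included. -/
theorem HasLaplaceExponent.bromwich_eq_zero (h : HasLaplaceExponent ν lam t μ)
    (hpos : μ (Iio 0) = 0) {x : ℝ} (hx : x ≤ 0) : bromwich ν lam 0 t x = 0 := by
  have hc := Complex.continuous_re.comp (continuous_bromwich hν hν' hlam ht 0)
  have hz : (fun x => (bromwich ν lam 0 t x).re) =ᵐ[volume.restrict (Iic 0)] fun _ => 0 := by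
    have h1 := hpos
    rw [h.eq_withDensity hν hν' hlam ht hpos, withDensity_apply _ measurableSet_Iio,
      lintegral_eq_zero_iff (by exact ENNReal.measurable_ofReal.comp hc.measurable),
      restrict_Iio_eq_restrict_Iic] at h1
    filter_upwards [h1] with y hy
    exact le_antisymm (ENNReal.ofReal_eq_zero.1 hy)
      (h.re_bromwich_nonneg hν hν' hlam ht hpos y)
  have := Measure.eqOn_of_ae_eq hz hc.continuousOn continuousOn_const
    (by rw [interior_Iic, closure_Iio]) hx
  rw [← h.ofReal_re_bromwich hν hν' hlam ht hpos]
  simpa using this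

theorem HasLaplaceExponent.eq_withDensity_restrict (h : HasLaplaceExponent ν lam t μ)
    (hpos : μ (Iio 0) = 0) :
    μ = (volume.restrict (Ici (0 : ℝ))).withDensity
      fun x => ENNReal.ofReal (bromwich ν lam 0 t x).re := by
  conv_lhs => rw [h.eq_withDensity hν hν' hlam ht hpos]
  rw [← withDensity_indicator measurableSet_Ici]
  congr 1
  ext x
  by_cases hx : x ∈ Ici (0 : ℝ)
  · rw [indicator_of_mem hx]
  · rw [indicator_of_notMem hx, h.bromwich_eq_zero hν hν' hlam ht hpos (le_of_lt (not_le.1 hx))]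
    simp

/-- The Riemann–Liouville fractional integrals of the density. -/
theorem HasLaplaceExponent.rlIntegral_bromwich (h : HasLaplaceExponent ν lam t μ)
    (hpos : μ (Iio 0) = 0) {α : ℝ} (hα : α < 1) {x : ℝ} (hx : 0 < x) :
    rlIntegral α (fun y => (bromwich ν lam 0 t y).re) x = (bromwich ν lam (α - 1) t x).re := by
  have hΓ : Real.Gamma (1 - α) ≠ 0 := (Real.Gamma_pos_of_pos (by linarith)).ne'
  have key := integral_rpow_neg_mul_bromwich hν hν' hlam ht hα x
  have h1 : ∀ u : ℝ, ((u ^ (-α) : ℝ) : ℂ) * bromwich ν lam 0 t (x - u) =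
      ((u ^ (-α) * (bromwich ν lam 0 t (x - u)).re : ℝ) : ℂ) := fun u => by
    rw [Complex.ofReal_mul, h.ofReal_re_bromwich hν hν' hlam ht hpos]
  simp_rw [h1] at key
  rw [integral_complex_ofReal] at key
  have key' := congrArg Complex.re key
  rw [Complex.ofReal_re, Complex.re_ofReal_mul] at key'
  have h2 : ∫ s in (0 : ℝ)..x, (bromwich ν lam 0 t s).re / (x - s) ^ α =
      ∫ u in (0 : ℝ)..x, (bromwich ν lam 0 t (x - u)).re / u ^ α := by
    have := intervalIntegral.integral_comp_sub_left (a := 0) (b := x)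
      (fun s => (bromwich ν lam 0 t s).re / (x - s) ^ α) x
    simpa using this.symm
  -- For u ≥ x the density at x - u is zero, so the range extends to (0,∞).
  have h3 : ∫ u in (0 : ℝ)..x, (bromwich ν lam 0 t (x - u)).re / u ^ α =
      ∫ u in Ioi (0 : ℝ), u ^ (-α) * (bromwich ν lam 0 t (x - u)).re := by
    rw [intervalIntegral.integral_of_le hx.le]
    rw [setIntegral_eq_of_subset_of_forall_sdiff_eq_zero measurableSet_Ioi
      (Ioc_subset_Ioi_self (a := x) (b := (0 : ℝ))) ?_]
    · refine setIntegral_congr_fun measurableSet_Ioc fun u hu => ?_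
      rw [Real.rpow_neg (le_of_lt hu.1), div_eq_mul_inv, mul_comm]
    · intro u hu
      have : x ≤ u := by
        by_contra hcon
        exact hu.2 ⟨hu.1, (not_le.1 hcon).le⟩
      rw [h.bromwich_eq_zero hν hν' hlam ht hpos (by linarith)]
      simp
  rw [rlIntegral, h2, h3, key']
  field_simp

/-- The fractional integral is B_(α-1) near x, and differentiation in x raises the exponent by 1. -/
theorem HasLaplaceExponent.hasDerivAt_rlIntegral (h : HasLaplaceExponent ν lam t μ)
    (hpos : μ (Iio 0) = 0) {α : ℝ} (hα : α < 1) {x : ℝ} (hx : 0 < x) :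
    HasDerivAt (rlIntegral α fun y => (bromwich ν lam 0 t y).re) (bromwich ν lam α t x).re x := by
  have h1 := hasDerivAt_bromwich_right hν hν' hlam ht (α - 1) x
  rw [sub_add_cancel] at h1
  have h2 := (Complex.reCLM.hasFDerivAt.comp_hasDerivAt x h1)
  refine h2.congr_of_eventuallyEq ?_
  filter_upwards [Ioi_mem_nhds hx] with y hy
  exact h.rlIntegral_bromwich hν hν' hlam ht hpos hα hy

end Law

/-- The singularity at s = y is integrable because α < 1. This is the convergence half of
`RLDifferentiableAt`. -/
theorem intervalIntegrable_div_rpow {f : ℝ → ℝ} {α y : ℝ} (hα : α < 1) (hy : 0 ≤ y)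
    (hf : ContinuousOn f (Ici 0)) :
    IntervalIntegrable (fun s => f s / (y - s) ^ α) volume 0 y := by
  have h1 : IntervalIntegrable (fun s : ℝ => (y - s) ^ (-α)) volume 0 y := by
    have := (intervalIntegral.intervalIntegrable_rpow' (a := 0) (b := y) (r := -α)
      (by linarith)).comp_sub_left y
    simpa using this.symm
  have h2 := h1.continuousOn_mul (g := f) (hf.mono (by
    rw [uIcc_of_le hy]; exact Icc_subset_Ici_self))
  refine h2.congr fun s hs => ?_
  rw [uIoc_of_le hy] at hs
  rw [Real.rpow_neg (by linarith [hs.2]), div_eq_mul_inv]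

/-! ### The sum of the two subordinators -/

section Subordinator

variable {Ω : Type*} [MeasurableSpace Ω] {P : Measure Ω} {H₁ H₂ : ℝ≥0 → Ω → ℝ} {ν lam : ℝ}

theorem IsStableSubordinator.ae_nonneg {α : ℝ} (h : IsStableSubordinator α H₁ P) (t : ℝ≥0) :
    ∀ᵐ ω ∂P, 0 ≤ H₁ t ω := by
  filter_upwards [h.start_zero, h.monotone_paths] with ω h0 hm
  simpa [h0] using hm (zero_le (a := t))

theorem IsStableSubordinator.mgf_neg {α : ℝ} (h : IsStableSubordinator α H₁ P) (t : ℝ≥0) {r : ℝ}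
    (hr : 0 < r) : mgf (H₁ t) P (-r) = Real.exp (-(t : ℝ) * r ^ α) :=
  h.laplace t r hr

theorem measurable_sumProcess {α β : ℝ} (h₁ : IsStableSubordinator α H₁ P)
    (h₂ : IsStableSubordinator β H₂ P) (t : ℝ≥0) : Measurable (sumProcess ν lam H₁ H₂ t) :=
  (h₁.measurable t).add ((h₂.measurable t).const_mul _)

theorem sumProcess_ae_nonneg {α β : ℝ} (h₁ : IsStableSubordinator α H₁ P)
    (h₂ : IsStableSubordinator β H₂ P) (hlam : 0 < lam) (t : ℝ≥0) :
    ∀ᵐ ω ∂P, 0 ≤ sumProcess ν lam H₁ H₂ t ω := by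
  filter_upwards [h₁.ae_nonneg t, h₂.ae_nonneg t] with ω ha hb
  unfold sumProcess
  positivity

theorem map_sumProcess_Iio {α β : ℝ} (h₁ : IsStableSubordinator α H₁ P)
    (h₂ : IsStableSubordinator β H₂ P) (hlam : 0 < lam) (t : ℝ≥0) :
    P.map (sumProcess ν lam H₁ H₂ t) (Iio 0) = 0 := by
  rw [Measure.map_apply (measurable_sumProcess h₁ h₂ t) measurableSet_Iio,
    measure_eq_zero_iff_ae_notMem]
  filter_upwards [sumProcess_ae_nonneg (ν := ν) h₁ h₂ hlam t] with ω hω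
  simpa using hω

theorem sumProcess_zero_ae {α β : ℝ} (h₁ : IsStableSubordinator α H₁ P)
    (h₂ : IsStableSubordinator β H₂ P) : ∀ᵐ ω ∂P, sumProcess ν lam H₁ H₂ 0 ω = 0 := by
  filter_upwards [h₁.start_zero, h₂.start_zero] with ω ha hb
  simp [sumProcess, ha, hb]

/-- The scaling c = (2λ)^(1/ν) is chosen so that (cr)^ν = 2λ r^ν; independence multiplies the two
transforms. -/
theorem hasLaplaceExponent_sumProcess (h₁ : IsStableSubordinator (2 * ν) H₁ P)
    (h₂ : IsStableSubordinator ν H₂ P)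
    (hindep : IndepFun (fun ω t => H₁ t ω) (fun ω t => H₂ t ω) P)
    (hν : 0 < ν) (hlam : 0 < lam) (t : ℝ≥0) :
    HasLaplaceExponent ν lam t (P.map (sumProcess ν lam H₁ H₂ t)) := by
  intro r hr
  have hc : 0 < (2 * lam) ^ (1 / ν) := by positivity
  have hm₁ := h₁.measurable t
  have hm₂ := h₂.measurable t
  have hind : IndepFun (H₁ t) (fun ω => (2 * lam) ^ (1 / ν) * H₂ t ω) P :=
    hindep.comp (measurable_pi_apply t) ((measurable_pi_apply t).const_mul _)
  rw [mgf_id_map (measurable_sumProcess h₁ h₂ t).aemeasurable]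
  have hadd := hind.mgf_add (t := -r) (by fun_prop) (by fun_prop)
  have hsum : sumProcess ν lam H₁ H₂ t = H₁ t + fun ω => (2 * lam) ^ (1 / ν) * H₂ t ω := rfl
  rw [hsum, hadd, h₁.mgf_neg t hr, mgf_const_mul, mul_neg, h₂.mgf_neg t (mul_pos hc hr),
    ← Real.exp_add, Real.mul_rpow hc.le hr.le, ← Real.rpow_mul (by positivity),
    one_div_mul_cancel hν.ne', Real.rpow_one]
  congr 1
  ring

/-- Almost every path is right-continuous at 0 with value 0, and the constant ‖φ‖ dominates. -/
theorem tendsto_integral_sumProcess [IsProbabilityMeasure P] {α β : ℝ}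
    (h₁ : IsStableSubordinator α H₁ P) (h₂ : IsStableSubordinator β H₂ P) (φ : ℝ →ᵇ ℝ) :
    Tendsto (fun t : ℝ => ∫ ω, φ (sumProcess ν lam H₁ H₂ t.toNNReal ω) ∂P) (𝓝[>] 0)
      (𝓝 (φ 0)) := by
  have hφ : φ 0 = ∫ _, φ 0 ∂P := by simp
  rw [hφ]
  refine tendsto_integral_filter_of_dominated_convergence (fun _ => ‖φ‖)
    (Eventually.of_forall fun t => ?_) (Eventually.of_forall fun t => ae_of_all _ fun ω => ?_)
    (integrable_const _) ?_
  · exact (φ.continuous.measurable.comp (measurable_sumProcess h₁ h₂ _)).aestronglyMeasurable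
  · exact φ.norm_coe_le_norm _
  · filter_upwards [h₁.right_continuous_paths, h₂.right_continuous_paths,
      sumProcess_zero_ae (ν := ν) (lam := lam) h₁ h₂] with ω hr₁ hr₂ h0
    have ht : Tendsto Real.toNNReal (𝓝[>] 0) (𝓝[Ici 0] 0) := by
      refine tendsto_nhdsWithin_iff.2 ⟨?_, Eventually.of_forall fun t => mem_Ici.2 zero_le⟩
      have := (continuous_real_toNNReal.tendsto 0).mono_left (nhdsWithin_le_nhds (s := Ioi 0))
      simpa using this
    have h := ((hr₁ 0).tendsto.comp ht).add
      (((hr₂ 0).tendsto.comp ht).const_mul ((2 * lam) ^ (1 / ν)))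
    have h0' : H₁ 0 ω + (2 * lam) ^ (1 / ν) * H₂ 0 ω = 0 := h0
    rw [h0'] at h
    exact (φ.continuous.tendsto 0).comp h

end Subordinator

/-! ### Uniqueness of the density and conclusion -/

/-- Densities of the same law agree almost everywhere on [0,∞), and continuity up to the endpoint
makes this pointwise. Nonnegativity is what lets `ENNReal.ofReal` be cancelled. -/
theorem isContinuousDensity_unique {Ω : Type*} [MeasurableSpace Ω] {X : ℝ≥0 → Ω → ℝ}
    {P : Measure Ω} {h g : ℝ → ℝ → ℝ} (hh : IsContinuousDensity X P h)
    (hg : IsContinuousDensity X P g) {t : ℝ} (ht : 0 < t) :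
    EqOn (fun x => h x t) (fun x => g x t) (Ici 0) := by
  have ht' : (0 : ℝ≥0) < ⟨t, ht.le⟩ := ht
  have hch : ContinuousOn (fun x => h x t) (Ici 0) := hh.continuousOn _ ht'
  have hcg : ContinuousOn (fun x => g x t) (Ici 0) := hg.continuousOn _ ht'
  have heq := (hh.map_eq _ ht').symm.trans (hg.map_eq _ ht')
  rw [withDensity_eq_iff_of_sigmaFinite
    (by exact ENNReal.measurable_ofReal.comp_aemeasurable (hch.aemeasurable measurableSet_Ici))
    (by exact ENNReal.measurable_ofReal.comp_aemeasurable (hcg.aemeasurable measurableSet_Ici))] at heq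
  refine Measure.eqOn_of_ae_eq (μ := volume) ?_ hch hcg (by rw [interior_Ici, closure_Ioi])
  filter_upwards [heq, ae_restrict_mem measurableSet_Ici] with x hx hx0
  exact (ENNReal.ofReal_eq_ofReal_iff (hh.nonneg _ ht' x hx0) (hg.nonneg _ ht' x hx0)).1 hx

theorem rlIntegral_congr {f g : ℝ → ℝ} (hfg : EqOn f g (Ici 0)) (α : ℝ) {x : ℝ} (hx : 0 ≤ x) :
    rlIntegral α f x = rlIntegral α g x := by
  unfold rlIntegral
  congr 1
  refine intervalIntegral.integral_congr fun s hs => ?_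
  rw [uIcc_of_le hx] at hs
  rw [hfg hs.1]

theorem mainTheorem5 {Ω : Type*} [MeasurableSpace Ω] (P : Measure Ω) [IsProbabilityMeasure P]
    (ν lam : ℝ) (hν : 0 < ν) (hν' : ν < 1 / 2) (hlam : 0 < lam)
    (H₁ H₂ : ℝ≥0 → Ω → ℝ)
    (hH₁ : IsStableSubordinator (2 * ν) H₁ P) (hH₂ : IsStableSubordinator ν H₂ P)
    (hindep : IndepFun (fun ω t => H₁ t ω) (fun ω t => H₂ t ω) P) :
    (∃ h : ℝ → ℝ → ℝ, IsContinuousDensity (sumProcess ν lam H₁ H₂) P h) ∧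
    (∀ h : ℝ → ℝ → ℝ, IsContinuousDensity (sumProcess ν lam H₁ H₂) P h →
      SolvesFractionalProblem ν lam h) ∧
    P.map (sumProcess ν lam H₁ H₂ 0) = Measure.dirac 0 := by
  have hmeas (t : ℝ≥0) : Measurable (sumProcess ν lam H₁ H₂ t) := measurable_sumProcess hH₁ hH₂ t
  have hfin (t : ℝ≥0) : IsFiniteMeasure (P.map (sumProcess ν lam H₁ H₂ t)) := inferInstance
  have hpos (t : ℝ≥0) : P.map (sumProcess ν lam H₁ H₂ t) (Iio 0) = 0 :=
    map_sumProcess_Iio hH₁ hH₂ hlam t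
  have hlap (t : ℝ≥0) := hasLaplaceExponent_sumProcess hH₁ hH₂ hindep hν hlam t
  have hdens : IsContinuousDensity (sumProcess ν lam H₁ H₂) P
      fun x t => (bromwich ν lam 0 t x).re := by
    refine ⟨fun t ht x _ => ?_, fun t ht => ?_, fun t ht => ?_⟩
    · exact (hlap t).re_bromwich_nonneg hν hν' hlam ht (hpos t) x
    · exact (Complex.continuous_re.comp
        (continuous_bromwich hν hν' hlam (NNReal.coe_pos.2 ht) 0)).continuousOn
    · exact (hlap t).eq_withDensity_restrict hν hν' hlam ht (hpos t)
  refine ⟨⟨_, hdens⟩, fun h hh => ?_, ?_⟩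
  -- An arbitrary continuous density agrees with B_0 on [0,∞) only; that suffices, since fractional
  -- integrals at x > 0 see no negative arguments.
  · have heq {t : ℝ} (ht : 0 < t) := isContinuousDensity_unique hh hdens ht
    have hrl {t : ℝ} (ht : 0 < t) {x : ℝ} (hx : 0 < x) {α : ℝ} (hα : α < 1) :
        HasDerivAt (rlIntegral α fun y => h y t) (bromwich ν lam α t x).re x := by
      have h1 := (hlap ⟨t, ht.le⟩).hasDerivAt_rlIntegral hν hν' hlam ht (hpos ⟨t, ht.le⟩) hα hx
      refine h1.congr_of_eventuallyEq ?_
      filter_upwards [Ioi_mem_nhds hx] with y hy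
      exact rlIntegral_congr (heq ht) α (le_of_lt hy)
    have hdiff {t : ℝ} (ht : 0 < t) {x : ℝ} (hx : 0 < x) {α : ℝ} (hα : α < 1) :
        RLDifferentiableAt α (fun y => h y t) x := by
      refine ⟨?_, (hrl ht hx hα).differentiableAt⟩
      filter_upwards [Ioi_mem_nhds hx] with y hy
      exact intervalIntegrable_div_rpow hα (le_of_lt hy) (hh.continuousOn ⟨t, ht.le⟩ ht)
    refine ⟨fun x t hx ht => hdiff ht hx (by linarith), fun x t hx ht => hdiff ht hx (by linarith),
      fun x t hx ht => ?_, fun t ht => ?_, fun φ => ?_⟩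
    · have h1 := Complex.reCLM.hasFDerivAt.comp_hasDerivAt t
        (hasDerivAt_bromwich_time hν hν' hlam ht x)
      have h2 : HasDerivAt (fun s => h x s) _ t := h1.congr_of_eventuallyEq (by
        filter_upwards [Ioi_mem_nhds ht] with s hs
        exact heq hs hx.le)
      refine h2.congr_deriv ?_
      rw [rlDeriv, rlDeriv, (hrl ht hx (by linarith)).deriv, (hrl ht hx (by linarith)).deriv]
      simp
    · have h1 := heq ht (mem_Ici.2 le_rfl)
      simp only at h1
      rw [h1, (hlap ⟨t, ht.le⟩).bromwich_eq_zero hν hν' hlam ht (hpos ⟨t, ht.le⟩) le_rfl,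
        Complex.zero_re]
    -- For t > 0 the integral against the density is the expectation of φ of the process, whose
    -- limit is known from the paths.
    · refine (tendsto_integral_sumProcess (ν := ν) (lam := lam) hH₁ hH₂ φ).congr' ?_
      filter_upwards [self_mem_nhdsWithin] with t ht
      have ht' : 0 < t.toNNReal := Real.toNNReal_pos.2 ht
      have ht0 : (t.toNNReal : ℝ) = t := Real.coe_toNNReal t (le_of_lt ht)
      have hc : Continuous fun x => (bromwich ν lam 0 t x).re :=
        Complex.continuous_re.comp (continuous_bromwich hν hν' hlam ht 0)
      rw [← integral_map (hmeas _).aemeasurable φ.continuous.aestronglyMeasurable,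
        hdens.map_eq _ ht', ht0, integral_withDensity_eq_integral_toReal_smul
          (by exact ENNReal.measurable_ofReal.comp hc.measurable)
          (ae_of_all _ fun _ => ENNReal.ofReal_lt_top)]
      refine setIntegral_congr_fun measurableSet_Ici fun x hx => ?_
      have hnn := hdens.nonneg _ ht' x hx
      have hx' : h x t = (bromwich ν lam 0 t x).re := heq ht hx
      rw [ht0] at hnn
      simp only [hx']
      rw [ENNReal.toReal_ofReal hnn, smul_eq_mul, mul_comm]
  · rw [Measure.map_congr (sumProcess_zero_ae hH₁ hH₂ : _ =ᵐ[P] fun _ => (0 : ℝ)),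
      Measure.map_const, measure_univ, one_smul]
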